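/- Let $\mathcal A$ be an abelian category with enough projectives and enough injectives. Let $\mathcal P$ (resp. $\mathcal I$) be the full subcategory of projective (resp. injective) objects of $\mathcal A$. For a full additive subcategory $\mathcal X\subseteq\mathcal A$, let $\mathcal A/[\mathcal X]$ be the factor category, which has the same objects as $\mathcal A$ and whose morphisms are the morphisms of $\mathcal A$ modulo those factoring through an object of $\mathcal X$. Write $\underline{\mathcal A}=\mathcal A/[\mathcal P]$ and $\overline{\mathcal A}=\mathcal A/[\mathcal I]$ for the stable categories. Let $\mathbf K^b(-)$ denote the bounded homotopy category of an additive category, and let $\mathbf K^b(\mathcal A)/\mathbf K^b(\mathcal X)$ be the Verdier quotient, i.e. the localization of $\mathbf K^b(\mathcal A)$ at the morphisms whose cone is isomorphic to an object of $\mathbf K^b(\mathcal X)$. The canonical functor $\mathbf K^b(\mathcal A)/\mathbf K^b(\mathcal X)\to\mathbf K^b(\mathcal A/[\mathcal X])$ is the one induced by the projection $\mathcal A\to\mathcal A/[\mathcal X]$; it sends a complex in $\mathcal A$ to the same complex viewed in $\mathcal A/[\mathcal X]$. Then the following statements are equivalent: 1. the canonical functor $\mathbf K^b(\mathcal A)/\mathbf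 K^b(\mathcal P)\to\mathbf K^b(\underline{\mathcal A})$ is an equivalence; 2. $\mathcal A$ is hereditary, i.e. its global dimension is at most one (every object has projective dimension at most one); 3. the canonical functor $\mathbf K^b(\mathcal A)/\mathbf K^b(\mathcal I)\to\mathbf K^b(\overline{\mathcal A})$ is an equivalence. -/

import Mathlib

open CategoryTheory CategoryTheory.Limits CategoryTheory.Pretriangulated
open scoped ZeroObject

universe v u

noncomputable section

namespace AdditiveQuotient

/-! ### The factor category `A/[X]` of an additive category -/

section Factor

variable {C : Type u} [Category.{v} C] [Preadditive C]

/-- The congruence attached to the ideal `[X]`: two parallel morphisms are related when their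
difference factors through an object of `X`. -/
def factorRel (X : ObjectProperty C) : HomRel C := fun A B f g =>
  ∃ (Z : C) (_ : X Z) (a : A ⟶ Z) (b : Z ⟶ B), a ≫ b = f - g

variable [HasBinaryBiproducts C] (X : ObjectProperty C) [X.IsClosedUnderBinaryProducts]

lemma factorRel_add {A B : C} {f₁ f₂ g₁ g₂ : A ⟶ B}
    (hf : factorRel X f₁ f₂) (hg : factorRel X g₁ g₂) :
    factorRel X (f₁ + g₁) (f₂ + g₂) := by
  obtain ⟨Z, hZ, a, b, h⟩ := hf
  obtain ⟨W, hW, c, d, h'⟩ := hg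
  refine ⟨Z ⊞ W, X.prop_of_isLimit_binaryFan (BinaryBiproduct.isLimit Z W) hZ hW,
    biprod.lift a c, biprod.desc b d, ?_⟩
  rw [biprod.lift_desc, h, h']
  abel

variable [X.ContainsZero]

instance factorRel_congruence : Congruence (factorRel X) where
  comp_left := by
    rintro A B D f g g' ⟨Z, hZ, a, b, h⟩
    exact ⟨Z, hZ, f ≫ a, b, by rw [Category.assoc, h, Preadditive.comp_sub]⟩
  comp_right := by
    rintro A B D f f' g ⟨Z, hZ, a, b, h⟩
    exact ⟨Z, hZ, a, b ≫ g, by rw [← Category.assoc, h, Preadditive.sub_comp]⟩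
  equivalence :=
    { refl := fun f => by
        obtain ⟨Z, _, hZ⟩ := ObjectProperty.ContainsZero.exists_zero (P := X)
        exact ⟨Z, hZ, 0, 0, by simp⟩
      symm := by
        rintro f g ⟨Z, hZ, a, b, h⟩
        exact ⟨Z, hZ, -a, b, by rw [Preadditive.neg_comp, h, neg_sub]⟩
      trans := by
        intro f g k hfg hgk
        obtain ⟨Z, hZ, a, b, h⟩ := factorRel_add X hfg hgk
        exact ⟨Z, hZ, a, b, by rw [h]; abel⟩ }

/-- The factor category `C/[X]`: same objects as `C`, morphisms of `C` modulo those factoring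
through an object of `X`. -/
abbrev FactorCategory := CategoryTheory.Quotient (factorRel X)

instance : Preadditive (FactorCategory X) :=
  CategoryTheory.Quotient.preadditive _ (fun _ _ _ _ _ _ hf hg => factorRel_add X hf hg)

/-- The projection `C ⥤ C/[X]`, `f ↦ [f]`. -/
abbrev factorFunctor : C ⥤ FactorCategory X := CategoryTheory.Quotient.functor (factorRel X)

instance : (factorFunctor X).Additive where
  map_add := rfl

instance [HasZeroObject C] : HasZeroObject (FactorCategory X) := (factorFunctor X).hasZeroObject_of_additive

instance : HasBinaryBiproducts (FactorCategory X) where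
  has_binary_biproduct := by
    rintro ⟨A⟩ ⟨B⟩
    have := preservesBinaryBiproducts_of_preservesBiproducts (factorFunctor X)
    exact inferInstanceAs
      (HasBinaryBiproduct ((factorFunctor X).obj A) ((factorFunctor X).obj B))

lemma isZero_factorFunctor_obj {A : C} (hA : X A) : IsZero ((factorFunctor X).obj A) := by
  rw [IsZero.iff_id_eq_zero, ← (factorFunctor X).map_id, ← (factorFunctor X).map_zero]
  exact CategoryTheory.Quotient.sound _ ⟨A, hA, 𝟙 A, 𝟙 A, by simp⟩

end Factor

/-! ### The bounded homotopy category `K^b` -/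

section Bounded

variable (C : Type u) [Category.{v} C] [Preadditive C]

/-- The cochain complexes `K` with `K.X i` zero for all but finitely many `i`. -/
def boundedComplex : ObjectProperty (CochainComplex C ℤ) := fun K =>
  ∃ m n : ℤ, ∀ i : ℤ, (i < m ∨ n < i) → IsZero (K.X i)

/-- The objects of the homotopy category given by bounded complexes. -/
def bounded : ObjectProperty (HomotopyCategory C (.up ℤ)) := fun K =>
  boundedComplex C K.as

/-- The bounded homotopy category `K^b(C)`. -/
abbrev Kb := (bounded C).FullSubcategory

instance [HasZeroObject C] : (bounded C).ContainsZero where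
  exists_zero :=
    ⟨(HomotopyCategory.quotient _ _).obj 0, Functor.map_isZero _ (isZero_zero _),
      0, 0, fun i _ => (HomologicalComplex.eval C (.up ℤ) i).map_isZero (isZero_zero _)⟩

instance : (bounded C).IsStableUnderShift ℤ where
  isStableUnderShiftBy a :=
    { le_shift := by
        intro K hK
        obtain ⟨K : CochainComplex C ℤ, rfl⟩ := K.quotient_obj_surjective
        obtain ⟨m, n, h⟩ := hK
        rw [ObjectProperty.prop_shift_iff, HomotopyCategory.shift_quotient_obj]
        exact ⟨m - a, n - a, fun i hi => h (i + a) (by omega)⟩ }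

instance [HasZeroObject C] [HasBinaryBiproducts C] : (bounded C).IsTriangulatedClosed₃ where
  ext₃' T hT h₁ h₂ := by
    obtain ⟨m₁, n₁, h₁⟩ := h₁
    obtain ⟨m₂, n₂, h₂⟩ := h₂
    obtain ⟨f : T.obj₁.as ⟶ T.obj₂.as, hf⟩ :=
      (HomotopyCategory.quotient _ _).map_surjective T.mor₁
    refine ⟨(HomotopyCategory.quotient _ _).obj (CochainComplex.mappingCone f),
      ⟨min (m₁ - 1) m₂, max n₁ n₂, fun i hi => ?_⟩,
      ⟨Triangle.π₃.mapIso (isoTriangleOfIso₁₂ T _ hT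
        (HomotopyCategory.mappingCone_triangleh_distinguished f)
        (Iso.refl _) (Iso.refl _) (by
          exact (Category.comp_id _).trans (hf.symm.trans (Category.id_comp _).symm)))⟩⟩
    exact (CochainComplex.mappingCone.isZero_X_iff f i).2
      ⟨h₁ _ (by omega), h₂ _ (by omega)⟩

instance [HasZeroObject C] [HasBinaryBiproducts C] : (bounded C).IsTriangulated where
  toIsTriangulatedClosed₂ := .of_isTriangulatedClosed₃

variable {C}

/-- The full subcategory `K^b(X)` of `K^b(C)`: the bounded complexes whose terms all lie
in `X`. -/
def KbSub (X : ObjectProperty C) : ObjectProperty (Kb C) := fun K => ∀ i : ℤ, X (K.obj.as.X i)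

variable {D : Type*} [Category* D] [Preadditive D] (F : C ⥤ D) [F.Additive]

/-- The functor `K^b(C) ⥤ K^b(D)` induced by an additive functor, applied termwise. -/
def mapKb : Kb C ⥤ Kb D :=
  (bounded D).lift ((bounded C).ι ⋙ F.mapHomotopyCategory (.up ℤ)) (by
    rintro ⟨K, m, n, h⟩
    exact ⟨m, n, fun i hi => F.map_isZero (h i hi)⟩)

instance : (mapKb F).CommShift ℤ :=
  inferInstanceAs (((bounded D).lift ((bounded C).ι ⋙ F.mapHomotopyCategory (.up ℤ)) _).CommShift ℤ)

instance [HasZeroObject C] [HasBinaryBiproducts C] [HasZeroObject D] [HasBinaryBiproducts D] :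
    (mapKb F).IsTriangulated :=
  inferInstanceAs
    (((bounded D).lift ((bounded C).ι ⋙ F.mapHomotopyCategory (.up ℤ)) _).IsTriangulated)

end Bounded

/-! ### The Verdier quotient `K^b(C)/K^b(X)` and the canonical functor -/

section Canonical

variable {C : Type u} [Category.{v} C] [Preadditive C] [HasZeroObject C] [HasBinaryBiproducts C]
  (X : ObjectProperty C)

/-- The Verdier quotient `K^b(C)/K^b(X)`: the localization of `K^b(C)` at the morphisms whose
cone is isomorphic to an object of `K^b(X)`. -/
abbrev VerdierQuotient := (KbSub X).trW.Localization

variable [X.ContainsZero] [X.IsClosedUnderBinaryProducts]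

lemma isInvertedBy_mapKb_factorFunctor :
    (KbSub X).trW.IsInvertedBy (mapKb (factorFunctor X)) := by
  rintro K L f ⟨Z, g, h, hT, hZ⟩
  refine (Triangle.isZero₃_iff_isIso₁ _
    ((mapKb (factorFunctor X)).map_distinguished _ hT)).1 ?_
  have h0 : IsZero (((factorFunctor X).mapHomologicalComplex (.up ℤ)).obj Z.obj.as) := by
    rw [IsZero.iff_id_eq_zero]
    ext i
    exact (isZero_factorFunctor_obj X (hZ i)).eq_of_src _ _
  have h1 : IsZero (((mapKb (factorFunctor X)).obj Z).obj) :=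
    (HomotopyCategory.quotient _ _).map_isZero h0
  rw [IsZero.iff_id_eq_zero]
  ext
  exact h1.eq_of_src _ _

/-- The canonical functor `K^b(C)/K^b(X) ⥤ K^b(C/[X])`, the unique functor whose composition with
the quotient functor `K^b(C) ⥤ K^b(C)/K^b(X)` is induced by the projection `C ⥤ C/[X]`. -/
def canonicalFunctor : VerdierQuotient X ⥤ Kb (FactorCategory X) :=
  Localization.Construction.lift (mapKb (factorFunctor X)) (isInvertedBy_mapKb_factorFunctor X)

end Canonical

/-! ### Abelian categories -/

section Abelian

variable (A : Type u) [Category.{v} A] [Abelian A]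

instance : (isProjective A).ContainsZero where
  exists_zero := ⟨0, isZero_zero A, inferInstanceAs (Projective (0 : A))⟩

instance : (isProjective A).IsClosedUnderBinaryProducts where
  limitsOfShape_le := by
    rintro Z ⟨p⟩
    have h₁ : Projective (p.diag.obj ⟨.left⟩) := p.prop_diag_obj ⟨.left⟩
    have h₂ : Projective (p.diag.obj ⟨.right⟩) := p.prop_diag_obj ⟨.right⟩
    have e : (p.diag.obj ⟨.left⟩ ⊞ p.diag.obj ⟨.right⟩) ≅ Z :=
      (BinaryBiproduct.isLimit _ _).conePointUniqueUpToIso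
        ((IsLimit.postcomposeHomEquiv (diagramIsoPair p.diag) _).2 p.isLimit)
    exact Projective.of_iso e inferInstance

/-- An abelian category is hereditary when its global dimension is at most one, i.e. every object
has projective dimension at most one. -/
def IsHereditary : Prop := ∀ M : A, HasProjectiveDimensionLE M 1

end Abelian

end AdditiveQuotient

end

/-!
The canonical functor `F : K^b(A)/K^b(X) ⥤ K^b(A/[X])` is triangulated, and the stalk complexes
generate both sides. By dévissage it is an equivalence as soon as it is bijective on morphisms
between stalk complexes. On those it is always surjective, since every morphism of `A/[X]` lifts
to `A` and there is nothing to lift between distinct degrees; so what is needed is that `F` kills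
no nonzero morphism between stalks (`canonicalFunctor_isEquivalence_of_eq_zero`).

Let `X` be the projectives and suppose that every object `b` has a resolution `0 ⟶ P₁ ⟶ P₀ ⟶ b ⟶ 0`.
In the Verdier quotient, the stalk `b` is isomorphic to the acyclic complex `y = (P₁ ⟶ P₀ ⟶ b)`.
Every bounded complex of projectives is K-projective, so `y` is right orthogonal to `K^b(P)` and
the morphisms to `y` in the quotient are those of `K^b(A)`. A morphism from a stalk to `y` which
vanishes in `K^b(A/[P])` is null-homotopic: in the degree of `b` it factors through a projective,
hence lifts along `P₀ ⟶ b`, and in the other degrees acyclicity of `y` suffices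
(`eq_zero_of_map_eq_zero_of_projective`).

Conversely, let `0 ⟶ X₁ ⟶ X₂ ⟶ X₃ ⟶ 0` be exact with `X₂` projective. The morphism from `X₁`, in
degree `-1`, to the cone `c` of `X₂ ⟶ X₃` becomes in the Verdier quotient a morphism between stalks
in different degrees, because `c` becomes isomorphic to `X₃` in degree `0`. It is killed by `F`, so
if `F` is faithful it vanishes in the quotient, that is, it factors through a bounded complex of
projectives. The component of this factorization in degree `-1` exhibits `X₁` as a retract of a
projective (`projective_X₁_of_factor`). Thus every kernel of an epimorphism from a projective is
projective, which is to say that the projective dimensions are at most one.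

The argument for the injectives is dual, and `Ext² = 0` is a self-dual form of hereditariness
(`isHereditary_iff_hasInjectiveDimensionLT`).
-/

noncomputable section

namespace AdditiveQuotient

/-! ### Fully faithful triangulated functors by dévissage -/

section Devissage

variable {D : Type*} [Category* D] {E : Type*} [Category* E] (F : D ⥤ E)

/-- `F` induces a bijection from the morphisms `x ⟶ y` to the morphisms `F x ⟶ F y`. -/
def BijectiveOn (x y : D) : Prop := Function.Bijective (F.map : (x ⟶ y) → _)

variable {F}

lemma BijectiveOn.of_iso {x x' y y' : D} (h : BijectiveOn F x y) (e : x ≅ x') (e' : y ≅ y') :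
    BijectiveOn F x' y' := by
  constructor
  · intro f g hfg
    replace hfg : F.map f = F.map g := hfg
    have : e.hom ≫ f ≫ e'.inv = e.hom ≫ g ≫ e'.inv :=
      h.1 (by rw [F.map_comp, F.map_comp, hfg, ← F.map_comp, ← F.map_comp])
    simpa using this
  · intro f
    obtain ⟨g, hg⟩ := h.2 (F.map e.hom ≫ f ≫ F.map e'.inv)
    refine ⟨e.inv ≫ g ≫ e'.hom, ?_⟩
    simp [hg]

variable [HasZeroObject D] [HasShift D ℤ] [Preadditive D]
  [∀ n : ℤ, (shiftFunctor D n).Additive] [Pretriangulated D]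
  [HasZeroObject E] [HasShift E ℤ] [Preadditive E]
  [∀ n : ℤ, (shiftFunctor E n).Additive] [Pretriangulated E]
variable (F) [F.CommShift ℤ] [F.IsTriangulated]

/-- The objects `x` such that `F` is bijective on the morphisms from all shifts of `x` to an object
satisfying `S`. -/
def bijectiveFrom (S : ObjectProperty D) : ObjectProperty D := fun x =>
  ∀ (n : ℤ) (y : D), S y → BijectiveOn F (x⟦n⟧) y

/-- The objects `y` such that `F` is bijective on the morphisms to all shifts of `y` from an object
satisfying `S`. -/
def bijectiveTo (S : ObjectProperty D) : ObjectProperty D := fun y =>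
  ∀ (n : ℤ) (x : D), S x → BijectiveOn F x (y⟦n⟧)

variable {F}

/-- The five lemma for `Hom(-, y)` along a distinguished triangle. -/
lemma BijectiveOn.of_distTriang_source (T : Triangle D) (hT : T ∈ distTriang D) (y : D)
    (h₁ : BijectiveOn F T.obj₁ y) (h₁' : BijectiveOn F (T.obj₁⟦(1 : ℤ)⟧) y)
    (h₃ : BijectiveOn F T.obj₃ y) (h₃' : BijectiveOn F (T.obj₃⟦(-1 : ℤ)⟧) y) :
    BijectiveOn F T.obj₂ y := by
  have hFT := F.map_distinguished T hT
  have hT' := inv_rot_of_distTriang _ hT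
  have z₂₃ := comp_distTriang_mor_zero₂₃ _ hT
  -- The four objects in the hypotheses and `T.obj₂` are consecutive in the long exact sequence,
  -- where `T.obj₃⟦-1⟧ ⟶ T.obj₁` is the first map of the inverse rotation of `T`.
  obtain ⟨w, z, hw⟩ : ∃ w : T.obj₃⟦(-1 : ℤ)⟧ ⟶ T.obj₁, w ≫ T.mor₁ = 0 ∧
      ∀ f : T.obj₁ ⟶ y, w ≫ f = 0 → ∃ g, f = T.mor₁ ≫ g :=
    ⟨T.invRotate.mor₁, comp_distTriang_mor_zero₁₂ _ hT', Triangle.yoneda_exact₂ _ hT'⟩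
  have ex₂ : ∀ f : F.obj T.obj₂ ⟶ F.obj y, F.map T.mor₁ ≫ f = 0 → ∃ k, f = F.map T.mor₂ ≫ k :=
    Triangle.yoneda_exact₂ _ hFT
  have ex₃ : ∀ f : F.obj T.obj₃ ⟶ F.obj y, F.map T.mor₂ ≫ f = 0 →
      ∃ k, f = (F.map T.mor₃ ≫ (F.commShiftIso (1 : ℤ)).hom.app T.obj₁) ≫ k :=
    Triangle.yoneda_exact₃ _ hFT
  constructor
  · rw [← Functor.coe_mapAddHom, injective_iff_map_eq_zero]
    intro g hg
    replace hg : F.map g = 0 := hg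
    obtain ⟨h, rfl⟩ := Triangle.yoneda_exact₂ T hT g
      (h₁.1 (by rw [F.map_comp, hg, comp_zero, F.map_zero]))
    obtain ⟨k, hk⟩ := ex₃ (F.map h) (by rw [← F.map_comp, hg])
    obtain ⟨k', hk'⟩ := h₁'.2 ((F.commShiftIso (1 : ℤ)).hom.app _ ≫ k)
    have : h = T.mor₃ ≫ k' := h₃.1 (by rw [hk, F.map_comp, hk', Category.assoc])
    rw [this, reassoc_of% z₂₃, zero_comp]
  · intro ψ
    obtain ⟨f, hf⟩ := h₁.2 (F.map T.mor₁ ≫ ψ)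
    obtain ⟨g, hg⟩ := hw f (h₃'.1 (by
      rw [F.map_comp, hf, ← F.map_comp_assoc, z, F.map_zero, zero_comp, F.map_zero]))
    obtain ⟨k, hk⟩ := ex₂ (ψ - F.map g) (by
      rw [Preadditive.comp_sub, ← F.map_comp, ← hg, hf, sub_self])
    obtain ⟨k', rfl⟩ := h₃.2 k
    refine ⟨g + T.mor₂ ≫ k', ?_⟩
    rw [F.map_add, F.map_comp]
    exact (sub_eq_iff_eq_add'.1 hk).symm

/-- The five lemma for `Hom(x, -)` along a distinguished triangle. -/
lemma BijectiveOn.of_distTriang_target (T : Triangle D) (hT : T ∈ distTriang D) (x : D)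
    (h₁ : BijectiveOn F x T.obj₁) (h₁' : BijectiveOn F x (T.obj₁⟦(1 : ℤ)⟧))
    (h₃ : BijectiveOn F x T.obj₃) (h₃' : BijectiveOn F x (T.obj₃⟦(-1 : ℤ)⟧)) :
    BijectiveOn F x T.obj₂ := by
  have hFT := F.map_distinguished T hT
  have hT' := inv_rot_of_distTriang _ hT
  have z₂₃ := comp_distTriang_mor_zero₂₃ _ hT
  obtain ⟨w, z, hw⟩ : ∃ w : T.obj₃⟦(-1 : ℤ)⟧ ⟶ T.obj₁, w ≫ T.mor₁ = 0 ∧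
      ∀ f : F.obj x ⟶ F.obj T.obj₁, f ≫ F.map T.mor₁ = 0 → ∃ g, f = g ≫ F.map w :=
    ⟨T.invRotate.mor₁, comp_distTriang_mor_zero₁₂ _ hT',
      Triangle.coyoneda_exact₂ _ (F.map_distinguished _ hT')⟩
  have ex₂ : ∀ f : F.obj x ⟶ F.obj T.obj₂, f ≫ F.map T.mor₂ = 0 → ∃ k, f = k ≫ F.map T.mor₁ :=
    Triangle.coyoneda_exact₂ _ hFT
  constructor
  · rw [← Functor.coe_mapAddHom, injective_iff_map_eq_zero]
    intro g hg
    replace hg : F.map g = 0 := hg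
    obtain ⟨h, rfl⟩ := Triangle.coyoneda_exact₂ T hT g
      (h₃.1 (by rw [F.map_comp, hg, zero_comp, F.map_zero]))
    obtain ⟨k, hk⟩ := hw (F.map h) (by rw [← F.map_comp, hg])
    obtain ⟨k', rfl⟩ := h₃'.2 k
    have : h = k' ≫ w := h₁.1 (by rw [F.map_comp, hk])
    rw [this, Category.assoc, z, comp_zero]
  · intro ψ
    obtain ⟨f, hf⟩ := h₃.2 (ψ ≫ F.map T.mor₂)
    obtain ⟨g, hg⟩ := Triangle.coyoneda_exact₃ _ hT f (h₁'.1 (by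
      rw [F.map_comp, hf, Category.assoc, ← F.map_comp, z₂₃, F.map_zero, comp_zero, F.map_zero]))
    obtain ⟨k, hk⟩ := ex₂ (ψ - F.map g) (by
      rw [Preadditive.sub_comp, ← F.map_comp, ← hg, hf, sub_self])
    obtain ⟨k', rfl⟩ := h₁.2 k
    refine ⟨g + k' ≫ T.mor₁, ?_⟩
    rw [F.map_add, F.map_comp]
    exact (sub_eq_iff_eq_add'.1 hk).symm

lemma BijectiveOn.of_isZero_source {x : D} (hx : IsZero x) (y : D) : BijectiveOn F x y :=
  ⟨fun _ _ _ => hx.eq_of_src _ _, fun _ => ⟨0, (F.map_isZero hx).eq_of_src _ _⟩⟩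

lemma BijectiveOn.of_isZero_target (x : D) {y : D} (hy : IsZero y) : BijectiveOn F x y :=
  ⟨fun _ _ _ => hy.eq_of_tgt _ _, fun _ => ⟨0, (F.map_isZero hy).eq_of_tgt _ _⟩⟩

variable (F)

instance (S : ObjectProperty D) : (bijectiveFrom F S).IsClosedUnderIsomorphisms where
  of_iso e h n y hy := (h n y hy).of_iso ((shiftFunctor D n).mapIso e) (Iso.refl _)

instance (S : ObjectProperty D) : (bijectiveTo F S).IsClosedUnderIsomorphisms where
  of_iso e h n x hx := (h n x hx).of_iso (Iso.refl _) ((shiftFunctor D n).mapIso e)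

instance (S : ObjectProperty D) : (bijectiveFrom F S).IsTriangulated where
  exists_zero := ⟨0, isZero_zero D, fun n y _ =>
    .of_isZero_source ((shiftFunctor D n).map_isZero (isZero_zero D)) y⟩
  isStableUnderShiftBy a :=
    { le_shift := fun x hx n y hy => (hx (a + n) y hy).of_iso ((shiftFunctorAdd D a n).app x)
        (Iso.refl _) }
  toIsTriangulatedClosed₂ := .mk' (fun T hT h₁ h₃ n y hy =>
    .of_distTriang_source _ (Triangle.shift_distinguished T hT n) y (h₁ n y hy)
      ((h₁ (n + 1) y hy).of_iso ((shiftFunctorAdd D n 1).app _) (Iso.refl _)) (h₃ n y hy)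
      ((h₃ (n + -1) y hy).of_iso ((shiftFunctorAdd D n (-1)).app _) (Iso.refl _)))

instance (S : ObjectProperty D) : (bijectiveTo F S).IsTriangulated where
  exists_zero := ⟨0, isZero_zero D, fun n x _ =>
    .of_isZero_target x ((shiftFunctor D n).map_isZero (isZero_zero D))⟩
  isStableUnderShiftBy a :=
    { le_shift := fun y hy n x hx => (hy (a + n) x hx).of_iso (Iso.refl _)
        ((shiftFunctorAdd D a n).app y) }
  toIsTriangulatedClosed₂ := .mk' (fun T hT h₁ h₃ n x hx =>
    .of_distTriang_target _ (Triangle.shift_distinguished T hT n) x (h₁ n x hx)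
      ((h₁ (n + 1) x hx).of_iso (Iso.refl _) ((shiftFunctorAdd D n 1).app _)) (h₃ n x hx)
      ((h₃ (n + -1) x hx).of_iso (Iso.refl _) ((shiftFunctorAdd D n (-1)).app _)))

end Devissage

/-! ### Bounded complexes as objects of `K^b` -/

section Bounded

variable {C : Type u} [Category.{v} C] [Preadditive C]

/-- A bounded complex, as an object of `K^b(C)`. -/
def kbObj (K : CochainComplex C ℤ) (hK : boundedComplex C K) : Kb C :=
  ⟨(HomotopyCategory.quotient C (.up ℤ)).obj K, hK⟩

/-- The homotopy class of a morphism of bounded complexes. -/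
def kbMap {x y : Kb C} (f : x.obj.as ⟶ y.obj.as) : x ⟶ y :=
  ObjectProperty.homMk ((HomotopyCategory.quotient C (.up ℤ)).map f)

lemma kbMap_surjective {x y : Kb C} (f : x ⟶ y) : ∃ φ : x.obj.as ⟶ y.obj.as, kbMap φ = f := by
  obtain ⟨φ, hφ⟩ := (HomotopyCategory.quotient C (.up ℤ)).map_surjective f.hom
  exact ⟨φ, ObjectProperty.hom_ext _ hφ⟩

lemma kbMap_comp {x y z : Kb C} (f : x.obj.as ⟶ y.obj.as) (g : y.obj.as ⟶ z.obj.as) :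
    kbMap (f ≫ g) = (kbMap f ≫ kbMap g : x ⟶ z) :=
  ObjectProperty.hom_ext _ ((HomotopyCategory.quotient C (.up ℤ)).map_comp f g)

lemma kbMap_eq_iff {x y : Kb C} (f g : x.obj.as ⟶ y.obj.as) :
    (kbMap f : x ⟶ y) = kbMap g ↔ Nonempty (Homotopy f g) :=
  ⟨fun h => ⟨HomotopyCategory.homotopyOfEq _ _ (congrArg (·.hom) h)⟩,
    fun ⟨h⟩ => ObjectProperty.hom_ext _ (HomotopyCategory.eq_of_homotopy _ _ h)⟩

lemma kbMap_zero {x y : Kb C} : (kbMap 0 : x ⟶ y) = 0 :=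
  ObjectProperty.hom_ext _ ((HomotopyCategory.quotient C (.up ℤ)).map_zero _ _)

lemma kb_hom_eq_zero {x y : Kb C} (h : ∀ i, IsZero (x.obj.as.X i) ∨ IsZero (y.obj.as.X i))
    (f : x ⟶ y) : f = 0 := by
  obtain ⟨φ, rfl⟩ := kbMap_surjective f
  rw [← kbMap_zero]
  congr 1
  ext i
  rcases h i with h | h
  · exact h.eq_of_src _ _
  · exact h.eq_of_tgt _ _

lemma isZero_kb {x : Kb C} (h : ∀ i, IsZero (x.obj.as.X i)) : IsZero x :=
  (IsZero.iff_id_eq_zero _).2 (kb_hom_eq_zero (fun i => .inl (h i)) _)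

lemma kb_shift_obj (K : Kb C) (n : ℤ) :
    (K⟦n⟧).obj = (HomotopyCategory.quotient C (.up ℤ)).obj (K.obj.as⟦n⟧) := by
  -- the shift on a full subcategory is an irreducible definition
  refine Eq.trans ?_ (HomotopyCategory.shift_quotient_obj K.obj.as n)
  with_unfolding_all rfl

lemma boundedComplex_mappingCone [HasBinaryBiproducts C] {K L : CochainComplex C ℤ} (f : K ⟶ L)
    (hK : boundedComplex C K) (hL : boundedComplex C L) :
    boundedComplex C (CochainComplex.mappingCone f) := by
  obtain ⟨m₁, n₁, h₁⟩ := hK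
  obtain ⟨m₂, n₂, h₂⟩ := hL
  exact ⟨min (m₁ - 1) m₂, max n₁ n₂, fun i hi =>
    (CochainComplex.mappingCone.isZero_X_iff f i).2 ⟨h₁ _ (by omega), h₂ _ (by omega)⟩⟩

lemma prop_mappingCone_X [HasBinaryBiproducts C] (X : ObjectProperty C)
    [X.IsClosedUnderIsomorphisms] [X.IsClosedUnderBinaryProducts]
    {K L : CochainComplex C ℤ} (f : K ⟶ L) (i : ℤ)
    (hK : X (K.X (i + 1))) (hL : X (L.X i)) : X ((CochainComplex.mappingCone f).X i) := by
  refine X.prop_of_iso ?_ (X.prop_of_isLimit_binaryFan (BinaryBiproduct.isLimit _ _) hK hL)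
  exact (HomologicalComplex.homotopyCofiber.XIsoBiprod f i (i + 1) rfl).symm

variable [HasZeroObject C]

/-- The stalk complex with `a` in degree `n`, as an object of `K^b(C)`. -/
def stalk (a : C) (n : ℤ) : Kb C :=
  kbObj ((HomologicalComplex.single C (.up ℤ) n).obj a) ⟨n, n, fun i hi =>
    HomologicalComplex.isZero_single_obj_X _ _ _ _ (by omega)⟩

lemma isZero_stalk_X (a : C) {n i : ℤ} (h : i ≠ n) : IsZero ((stalk a n).obj.as.X i) :=
  HomologicalComplex.isZero_single_obj_X _ _ _ _ h

lemma isZero_stalk_zero_X (n i : ℤ) : IsZero ((stalk (0 : C) n).obj.as.X i) := by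
  by_cases hi : i = n
  · exact (isZero_zero C).of_iso (HomologicalComplex.singleObjXIsoOfEq (.up ℤ) n 0 i hi)
  · exact isZero_stalk_X 0 hi

/-- Shifting a stalk complex moves its degree. -/
def stalkShiftIso (a : C) (n p q : ℤ) (h : n + p = q) : (stalk a q)⟦n⟧ ≅ stalk a p :=
  (bounded C).fullyFaithfulι.preimageIso
    (((bounded C).ι.commShiftIso n).app (stalk a q) ≪≫
      ((HomotopyCategory.singleFunctors C).shiftIso n p q h).app a)

variable [HasBinaryBiproducts C]

lemma exists_kb_distinguished {x y z : Kb C} (f : x ⟶ y) (g : y ⟶ z)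
    (h : z.obj ⟶ x.obj⟦(1 : ℤ)⟧)
    (hT : Triangle.mk f.hom g.hom h ∈ distTriang (HomotopyCategory C (.up ℤ))) :
    ∃ h' : z ⟶ x⟦(1 : ℤ)⟧, Triangle.mk f g h' ∈ distTriang (Kb C) := by
  let k := h ≫ ((bounded C).ι.commShiftIso (1 : ℤ)).inv.app x
  have hk : k ≫ ((bounded C).ι.commShiftIso (1 : ℤ)).hom.app x = h := by simp [k]
  refine ⟨(bounded C).fullyFaithfulι.preimage k, ?_⟩
  exact isomorphic_distinguished _ hT _ (Triangle.isoMk _ _ (Iso.refl _) (Iso.refl _)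
    (Iso.refl _) ((Category.comp_id _).trans (Category.id_comp _).symm)
    ((Category.comp_id _).trans (Category.id_comp _).symm)
    (((congrArg _ (CategoryTheory.Functor.map_id _ _)).trans (Category.comp_id _)).trans
      (hk.trans (Category.id_comp _).symm)))

/-- The mapping cone triangle of a morphism of bounded complexes. -/
lemma exists_cone_distinguished {x y : Kb C} (f : x.obj.as ⟶ y.obj.as)
    (hf : boundedComplex C (CochainComplex.mappingCone f)) :
    ∃ h : kbObj (CochainComplex.mappingCone f) hf ⟶ x⟦(1 : ℤ)⟧,
      Triangle.mk (kbMap f) (kbMap (CochainComplex.mappingCone.inr f)) h ∈ distTriang (Kb C) :=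
  exists_kb_distinguished _ _ _ (HomotopyCategory.mappingCone_triangleh_distinguished f)

section Sub

variable (X : ObjectProperty C) [X.IsClosedUnderIsomorphisms] [X.IsClosedUnderBinaryProducts]

instance [X.ContainsZero] : (KbSub X).IsTriangulated :=
  have : (KbSub X).IsStableUnderShift ℤ :=
    { isStableUnderShiftBy := fun a =>
        { le_shift := fun K hK i => by
            rw [kb_shift_obj]
            exact hK (i + a) } }
  have : (KbSub X).IsTriangulatedClosed₃ :=
    { ext₃' := fun T hT h₁ h₂ => by
        obtain ⟨f, hf⟩ := kbMap_surjective T.mor₁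
        have hb := boundedComplex_mappingCone f T.obj₁.property T.obj₂.property
        obtain ⟨h, hT'⟩ := exists_cone_distinguished f hb
        exact ⟨kbObj _ hb, fun i => prop_mappingCone_X X f i (h₁ _) (h₂ _),
          ⟨Triangle.π₃.mapIso (isoTriangleOfIso₁₂ T _ hT hT' (Iso.refl _) (Iso.refl _) (by
            exact (Category.comp_id _).trans (hf.symm.trans (Category.id_comp _).symm)))⟩⟩ }
  have hz (i : ℤ) : IsZero ((0 : CochainComplex C ℤ).X i) :=
    (HomologicalComplex.eval C (.up ℤ) i).map_isZero (isZero_zero _)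
  { exists_zero := ⟨kbObj 0 ⟨0, 0, fun i _ => hz i⟩, isZero_kb hz, fun i => X.prop_of_isZero (hz i)⟩
    toIsTriangulatedClosed₂ := .of_isTriangulatedClosed₃ }

end Sub

section Generation

/-- The stupid filtration step: a complex vanishing below degree `m` is an extension of the stalk
complex of its term in degree `m` by a complex which agrees with it outside degree `m`, and
vanishes in degree `m`. -/
lemma exists_stalk_distinguished (K : Kb C) (m : ℤ) (hm : ∀ i < m, IsZero (K.obj.as.X i)) :
    ∃ (K' : Kb C) (f : K' ⟶ K) (g : K ⟶ stalk (K.obj.as.X m) m)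
      (h : stalk (K.obj.as.X m) m ⟶ K'⟦(1 : ℤ)⟧),
      Triangle.mk f g h ∈ distTriang (Kb C) ∧
      ∀ i, (i ≤ m ∨ IsZero (K.obj.as.X i)) → IsZero (K'.obj.as.X i) := by
  obtain ⟨⟨K⟩, hK⟩ := K
  change ∀ i < m, IsZero (K.X i) at hm
  -- `Y i` is zero for `i = m` and `K.X i` otherwise, split off from `K.X i` by `j` and `r`.
  have ex : ∀ i, ∃ (Y : C) (j : Y ⟶ K.X i) (r : K.X i ⟶ Y), j ≫ r = 𝟙 _ ∧
      (i ≠ m → r ≫ j = 𝟙 _) ∧ (i = m → IsZero Y) := fun i => by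
    by_cases hi : i = m
    · exact ⟨0, 0, 0, (isZero_zero C).eq_of_src _ _, fun h => (h hi).elim, fun _ => isZero_zero C⟩
    · exact ⟨K.X i, 𝟙 _, 𝟙 _, by simp, fun _ => by simp, fun h => (hi h).elim⟩
  choose Y j r jr rj hY using ex
  let K' : CochainComplex C ℤ :=
    { X := Y
      d := fun i i' => j i ≫ K.d i i' ≫ r i'
      shape := fun i i' h => by rw [K.shape _ _ h, zero_comp, comp_zero]
      d_comp_d' := fun i i' i'' _ _ => by
        by_cases hi : i' = m
        · rw [(hY i' hi).eq_of_tgt (j i ≫ K.d i i' ≫ r i') 0, zero_comp]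
        · simp [reassoc_of% (rj i' hi)] }
  have hz : ∀ i, IsZero (K.X i) → IsZero (K'.X i) := fun i hi => by
    rw [IsZero.iff_id_eq_zero]
    exact (jr i).symm.trans (by rw [hi.eq_of_tgt (j i) 0, zero_comp])
  let φ : K' ⟶ K :=
    { f := j
      comm' := fun i i' hii' => by
        change j i ≫ K.d i i' = (j i ≫ K.d i i' ≫ r i') ≫ j i'
        by_cases hi : i' = m
        · have : IsZero (K.X i) := hm i (by subst hi; simp at hii'; omega)
          rw [this.eq_of_tgt (j i) 0, zero_comp, zero_comp, zero_comp]
        · simp [rj i' hi] }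
  let ψ : K ⟶ (HomologicalComplex.single C (.up ℤ) m).obj (K.X m) :=
    HomologicalComplex.mkHomToSingle (𝟙 _) (fun i hi => (hm i (by simp at hi; omega)).eq_of_src _ _)
  let S : ShortComplex (CochainComplex C ℤ) := ShortComplex.mk φ ψ (by
    ext
    exact (hY m rfl).eq_of_src _ _)
  have σ : ∀ n, Nonempty (S.map (HomologicalComplex.eval C (.up ℤ) n)).Splitting := fun n => by
    by_cases hn : n = m
    · subst hn
      refine ⟨⟨r n, (HomologicalComplex.singleObjXSelf (.up ℤ) n (K.X n)).hom,
        (hY n rfl).eq_of_src _ _, ?_, ?_⟩⟩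
      · change _ ≫ ψ.f n = 𝟙 _
        simp [ψ]
      · have h₁ : r n ≫ j n = 0 := by rw [(hY n rfl).eq_of_src (j n) 0, comp_zero]
        have h₂ : ψ.f n ≫ (HomologicalComplex.singleObjXSelf (.up ℤ) n (K.X n)).hom = 𝟙 _ := by
          simp [ψ]
        exact (congrArg₂ (· + ·) h₁ h₂).trans (zero_add _)
    · have hz := HomologicalComplex.isZero_single_obj_X (.up ℤ) m (K.X m) n hn
      refine ⟨⟨r n, 0, jr n, hz.eq_of_src _ _, ?_⟩⟩
      rw [comp_zero, add_zero]
      exact rj n hn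
  have hK' : boundedComplex C K' := by
    obtain ⟨a, b, h⟩ := hK
    exact ⟨a, b, fun i hi => hz i (h i hi)⟩
  obtain ⟨h, hT⟩ := exists_kb_distinguished (x := kbObj K' hK') (y := kbObj K hK)
    (z := stalk (K.X m) m) (kbMap φ) (kbMap ψ) _
    ((HomotopyCategory.distinguished_iff_iso_trianglehOfDegreewiseSplit _).2
      ⟨S, fun n => (σ n).some, ⟨Iso.refl _⟩⟩)
  refine ⟨_, _, _, h, hT, fun i hi => ?_⟩
  by_cases him : i = m
  · exact hY i him
  · rcases hi with hi | hi
    · exact hz i (hm i (by omega))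
    · exact hz i hi

/-- The stalk complexes generate `K^b(C)` under extensions. -/
lemma kb_induction (P : ObjectProperty (Kb C)) [P.IsClosedUnderIsomorphisms]
    [P.IsTriangulatedClosed₂] (h : ∀ (a : C) (n : ℤ), P (stalk a n)) (K : Kb C) :
    P K := by
  suffices ∀ (k : ℕ) (K : Kb C) (m : ℤ),
      (∀ i, i < m ∨ m + k ≤ i → IsZero (K.obj.as.X i)) → P K by
    obtain ⟨m, n, hK⟩ := K.property
    exact this (n + 1 - m).toNat K m (fun i hi => hK i (by omega))
  intro k
  induction k with
  | zero =>
    intro K m hK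
    exact P.prop_of_iso (IsZero.iso (isZero_kb fun i => isZero_stalk_zero_X 0 i)
      (isZero_kb fun i => hK i (by omega))) (h 0 0)
  | succ k ih =>
    intro K m hK
    obtain ⟨K', f, g, w, hT, hK'⟩ := exists_stalk_distinguished K m
      (fun i hi => hK i (.inl hi))
    refine P.ext_of_isTriangulatedClosed₂ _ hT (ih K' (m + 1) (fun i hi => hK' i ?_)) (h _ _)
    by_cases him : i ≤ m
    · exact .inl him
    · exact .inr (hK i (by push_cast; omega))

end Generation

end Bounded

/-! ### Reduction of the equivalence to stalk complexes -/

section Canonical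

variable {C : Type u} [Category.{v} C] [Preadditive C] [HasZeroObject C] [HasBinaryBiproducts C]
  (X : ObjectProperty C) [X.ContainsZero] [X.IsClosedUnderBinaryProducts]

/-- The quotient functor `K^b(C) ⥤ K^b(C)/K^b(X)`. -/
abbrev verdierQ : Kb C ⥤ VerdierQuotient X := (KbSub X).trW.Q

/-- The factorization of `K^b(C) ⥤ K^b(C/[X])` through the Verdier quotient. -/
def verdierQCompIso : verdierQ X ⋙ canonicalFunctor X ≅ mapKb (factorFunctor X) :=
  eqToIso (Localization.Construction.fac _ _)

instance : Localization.Lifting (verdierQ X) (KbSub X).trW (mapKb (factorFunctor X))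
    (canonicalFunctor X) :=
  ⟨verdierQCompIso X⟩

lemma canonicalFunctor_map_verdierQ_map_eq_zero_iff {K L : Kb C} (f : K ⟶ L) :
    (canonicalFunctor X).map ((verdierQ X).map f) = 0 ↔ (mapKb (factorFunctor X)).map f = 0 := by
  have := (verdierQCompIso X).hom.naturality f
  dsimp at this
  rw [← cancel_mono ((verdierQCompIso X).hom.app L), zero_comp, this]
  exact ⟨fun h => by rwa [← cancel_epi ((verdierQCompIso X).hom.app K), comp_zero],
    fun h => by rw [h, comp_zero]⟩

/-- The termwise image of a stalk complex is a stalk complex. -/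
def mapKbStalkIso (a : C) (n : ℤ) :
    (mapKb (factorFunctor X)).obj (stalk a n) ≅ stalk ((factorFunctor X).obj a) n :=
  (bounded _).isoMk ((HomotopyCategory.quotient _ _).mapIso
    ((HomologicalComplex.singleMapHomologicalComplex (factorFunctor X) (.up ℤ) n).app a))

/-- A morphism of `K^b(C/[X])` between stalk complexes lifts to `K^b(C)`. -/
lemma mapKb_map_surjective_of_stalk (a b : C) (p q : ℤ)
    (f : (mapKb (factorFunctor X)).obj (stalk a p) ⟶ (mapKb (factorFunctor X)).obj (stalk b q)) :
    ∃ g, (mapKb (factorFunctor X)).map g = f := by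
  obtain ⟨φ, rfl⟩ := kbMap_surjective f
  obtain ⟨ψ, hψ⟩ := (factorFunctor X).map_surjective (φ.f p)
  let γ : (stalk a p).obj.as ⟶ (stalk b q).obj.as := HomologicalComplex.mkHomFromSingle
    ((HomologicalComplex.singleObjXSelf (.up ℤ) p a).inv ≫ ψ) (fun k _ => comp_zero)
  refine ⟨kbMap γ, ?_⟩
  change kbMap (((factorFunctor X).mapHomologicalComplex (.up ℤ)).map γ) = kbMap φ
  congr 1
  ext i
  by_cases hi : i = p
  · subst hi
    refine Eq.trans ?_ hψ
    change (factorFunctor X).map (γ.f i) = _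
    congr 1
    exact (HomologicalComplex.mkHomFromSingle_f _ _).trans (Iso.hom_inv_id_assoc _ _)
  · exact ((factorFunctor X).map_isZero (isZero_stalk_X a hi)).eq_of_src _ _

lemma canonicalFunctor_map_surjective_of_stalk (a b : C) (p q : ℤ) :
    Function.Surjective ((canonicalFunctor X).map :
      ((verdierQ X).obj (stalk a p) ⟶ (verdierQ X).obj (stalk b q)) → _) := fun f => by
  obtain ⟨g, hg⟩ := mapKb_map_surjective_of_stalk X a b p q
    ((verdierQCompIso X).inv.app _ ≫ f ≫ (verdierQCompIso X).hom.app _)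
  refine ⟨(verdierQ X).map g, ?_⟩
  have := (verdierQCompIso X).hom.naturality g
  rw [← cancel_mono ((verdierQCompIso X).hom.app _)]
  refine this.trans ?_
  rw [hg]
  simp

/-- There are no nonzero morphisms between the images under the canonical functor of stalk
complexes in different degrees. -/
lemma canonicalFunctor_map_eq_zero_of_ne (a b : C) {p q : ℤ} (hpq : p ≠ q)
    (f : (verdierQ X).obj (stalk a p) ⟶ (verdierQ X).obj (stalk b q)) :
    (canonicalFunctor X).map f = 0 := by
  let e (a : C) (p : ℤ) := (verdierQCompIso X).app (stalk a p) ≪≫ mapKbStalkIso X a p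
  have : (e a p).inv ≫ (canonicalFunctor X).map f ≫ (e b q).hom = 0 :=
    kb_hom_eq_zero (fun i => by
      by_cases hi : i = p
      · exact .inr (isZero_stalk_X _ (by omega))
      · exact .inl (isZero_stalk_X _ hi)) _
  rw [← cancel_epi (e a p).inv, ← cancel_mono (e b q).hom]
  exact (Category.assoc _ _ _).trans (this.trans (by rw [comp_zero, zero_comp]))

variable [X.IsClosedUnderIsomorphisms]

instance : (canonicalFunctor X).CommShift ℤ :=
  Functor.commShiftOfLocalization (verdierQ X) (KbSub X).trW ℤ (mapKb (factorFunctor X)) _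

instance : (canonicalFunctor X).IsTriangulated :=
  have := Localization.essSurj_mapArrow (verdierQ X) (KbSub X).trW
  Functor.isTriangulated_of_precomp_iso
    (Localization.Lifting.iso (verdierQ X) (KbSub X).trW (mapKb (factorFunctor X))
      (canonicalFunctor X))

/-- A morphism which vanishes in the Verdier quotient factors through an object of `K^b(X)`. -/
lemma exists_factor_of_verdierQ_map_eq_zero {K L : Kb C} (f : K ⟶ L)
    (hf : (verdierQ X).map f = 0) :
    ∃ (N : Kb C) (_ : KbSub X N) (a : K ⟶ N) (b : N ⟶ L), f = a ≫ b := by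
  obtain ⟨Z, s, hs, h⟩ := (MorphismProperty.map_eq_iff_postcomp (verdierQ X) (KbSub X).trW f 0).1
    (hf.trans (Functor.map_zero _ _ _).symm)
  obtain ⟨N, i, w, hT, hN⟩ := ((KbSub X).trW_iff' s).1 hs
  obtain ⟨a, ha⟩ := Triangle.coyoneda_exact₂ _ hT f (h.trans zero_comp)
  exact ⟨N, hN, a, i, ha⟩

/-- Dévissage: the stalk complexes generate both sides, so that the canonical functor is an
equivalence as soon as it is bijective on morphisms between stalk complexes. -/
theorem canonicalFunctor_isEquivalence_of_stalk
    (h : ∀ (a b : C) (p q : ℤ), BijectiveOn (canonicalFunctor X)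
      ((verdierQ X).obj (stalk a p)) ((verdierQ X).obj (stalk b q))) :
    (canonicalFunctor X).IsEquivalence := by
  let S : ObjectProperty (VerdierQuotient X) := fun y =>
    ∃ (b : C) (q : ℤ), y = (verdierQ X).obj (stalk b q)
  let e (a : C) (p n : ℤ) : (verdierQ X).obj (stalk a (p - n)) ≅
      ((verdierQ X).obj (stalk a p))⟦n⟧ :=
    (verdierQ X).mapIso (stalkShiftIso a n (p - n) p (by omega)).symm ≪≫
      ((verdierQ X).commShiftIso n).app _
  have hQ (P : ObjectProperty (VerdierQuotient X)) [P.IsTriangulated]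
      [P.IsClosedUnderIsomorphisms] : (P.inverseImage (verdierQ X)).IsTriangulatedClosed₂ :=
    .mk' (fun T hT h₁ h₃ =>
      P.ext_of_isTriangulatedClosed₂ _ ((verdierQ X).map_distinguished T hT) h₁ h₃)
  have h₁ : ∀ K : Kb C, bijectiveFrom (canonicalFunctor X) S ((verdierQ X).obj K) :=
    kb_induction ((bijectiveFrom (canonicalFunctor X) S).inverseImage (verdierQ X)) (by
      rintro a p n _ ⟨b, q, rfl⟩
      exact (h a b (p - n) q).of_iso (e a p n) (Iso.refl _))
  -- The source is extended from stalks to all objects first, then the target.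
  have hsurj : ∀ y : VerdierQuotient X, ∃ K, y = (verdierQ X).obj K := fun y =>
    ⟨(Localization.Construction.objEquiv _).symm y,
      ((Localization.Construction.objEquiv _).apply_symm_apply y).symm⟩
  have h₂ : ∀ L : Kb C, bijectiveTo (canonicalFunctor X) ⊤ ((verdierQ X).obj L) :=
    kb_induction ((bijectiveTo (canonicalFunctor X) ⊤).inverseImage (verdierQ X)) (by
      rintro b q n x -
      obtain ⟨K, rfl⟩ := hsurj x
      exact (h₁ K 0 _ ⟨b, q - n, rfl⟩).of_iso ((shiftFunctorZero _ ℤ).app _) (e b q n))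
  have h₃ : ∀ x y, BijectiveOn (canonicalFunctor X) x y := fun x y => by
    obtain ⟨L, rfl⟩ := hsurj y
    exact (h₂ L 0 x trivial).of_iso (Iso.refl _) ((shiftFunctorZero _ ℤ).app _)
  have : (canonicalFunctor X).Full := ⟨fun f => (h₃ _ _).2 f⟩
  have : (canonicalFunctor X).Faithful := ⟨fun hfg => (h₃ _ _).1 hfg⟩
  have : (canonicalFunctor X).EssSurj := ⟨fun K =>
    have : (canonicalFunctor X).essImage.IsTriangulated := inferInstance
    kb_induction (canonicalFunctor X).essImage (by
      rintro ⟨a⟩ n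
      exact ⟨_, ⟨(verdierQCompIso X).app (stalk a n) ≪≫ mapKbStalkIso X a n⟩⟩) K⟩
  exact { }

/-- The canonical functor is an equivalence as soon as it kills no nonzero morphism between stalk
complexes. -/
theorem canonicalFunctor_isEquivalence_of_eq_zero
    (h : ∀ (a b : C) (p q : ℤ) (f : (verdierQ X).obj (stalk a p) ⟶ (verdierQ X).obj (stalk b q)),
      (canonicalFunctor X).map f = 0 → f = 0) :
    (canonicalFunctor X).IsEquivalence :=
  canonicalFunctor_isEquivalence_of_stalk X fun a b p q =>
    ⟨by
      rw [← Functor.coe_mapAddHom, injective_iff_map_eq_zero]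
      exact h a b p q, canonicalFunctor_map_surjective_of_stalk X a b p q⟩

end Canonical

/-! ### Morphisms from and to complexes concentrated in one degree -/

section Homotopy

variable {C : Type u} [Category.{v} C] [Preadditive C]

lemma kbMap_eq_zero_iff_of_isZero_source {x y : Kb C} (φ : x.obj.as ⟶ y.obj.as) (p : ℤ)
    (hx : ∀ i ≠ p, IsZero (x.obj.as.X i)) :
    (kbMap φ : x ⟶ y) = 0 ↔ ∃ h : x.obj.as.X p ⟶ y.obj.as.X (p - 1),
      φ.f p = h ≫ y.obj.as.d (p - 1) p := by
  have r₁ : (ComplexShape.up ℤ).Rel (p - 1) p := by simp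
  have r₂ : (ComplexShape.up ℤ).Rel p (p + 1) := by simp
  rw [← kbMap_zero, kbMap_eq_iff]
  constructor
  · rintro ⟨H⟩
    refine ⟨H.hom p (p - 1), ?_⟩
    have := H.comm p
    rw [dNext_eq _ r₂, prevD_eq _ r₁, (hx (p + 1) (by omega)).eq_of_src (H.hom (p + 1) p) 0] at this
    simpa using this
  · rintro ⟨h, hφ⟩
    let k (i j : ℤ) (hij : (ComplexShape.up ℤ).Rel j i) : x.obj.as.X i ⟶ y.obj.as.X j :=
      if hi : i = p then (x.obj.as.XIsoOfEq hi).hom ≫ h ≫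
        (y.obj.as.XIsoOfEq (show p - 1 = j by simp at hij; omega)).hom else 0
    have hk : φ = Homotopy.nullHomotopicMap' k := by
      ext i
      by_cases hi : i = p
      · subst hi
        rw [Homotopy.nullHomotopicMap'_f r₁ r₂,
          (hx (i + 1) (by omega)).eq_of_src (k _ _ r₂) 0, comp_zero, zero_add, hφ]
        simp [k]
      · exact (hx i hi).eq_of_src _ _
    rw [hk]
    exact ⟨Homotopy.nullHomotopy' k⟩

lemma kbMap_eq_zero_iff_of_isZero_target {x y : Kb C} (φ : x.obj.as ⟶ y.obj.as) (p : ℤ)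
    (hy : ∀ i ≠ p, IsZero (y.obj.as.X i)) :
    (kbMap φ : x ⟶ y) = 0 ↔ ∃ h : x.obj.as.X (p + 1) ⟶ y.obj.as.X p,
      φ.f p = x.obj.as.d p (p + 1) ≫ h := by
  have r₁ : (ComplexShape.up ℤ).Rel (p - 1) p := by simp
  have r₂ : (ComplexShape.up ℤ).Rel p (p + 1) := by simp
  rw [← kbMap_zero, kbMap_eq_iff]
  constructor
  · rintro ⟨H⟩
    refine ⟨H.hom (p + 1) p, ?_⟩
    have := H.comm p
    rw [dNext_eq _ r₂, prevD_eq _ r₁, (hy (p - 1) (by omega)).eq_of_tgt (H.hom p (p - 1)) 0] at this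
    simpa using this
  · rintro ⟨h, hφ⟩
    let k (i j : ℤ) (hij : (ComplexShape.up ℤ).Rel j i) : x.obj.as.X i ⟶ y.obj.as.X j :=
      if hj : j = p then (x.obj.as.XIsoOfEq (show i = p + 1 by simp at hij; omega)).hom ≫ h ≫
        (y.obj.as.XIsoOfEq hj).inv else 0
    have hk : φ = Homotopy.nullHomotopicMap' k := by
      ext i
      by_cases hi : i = p
      · subst hi
        rw [Homotopy.nullHomotopicMap'_f r₁ r₂,
          (hy (i - 1) (by omega)).eq_of_tgt (k _ _ r₁) 0, zero_comp, add_zero, hφ]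
        simp [k]
      · exact (hy i hi).eq_of_tgt _ _
    rw [hk]
    exact ⟨Homotopy.nullHomotopy' k⟩

variable [HasBinaryBiproducts C] (X : ObjectProperty C) [X.IsClosedUnderBinaryProducts]
  [X.ContainsZero]

lemma factorFunctor_map_eq_zero_iff {a b : C} (f : a ⟶ b) :
    (factorFunctor X).map f = 0 ↔ ∃ (Z : C) (_ : X Z) (g : a ⟶ Z) (h : Z ⟶ b), g ≫ h = f := by
  rw [← (factorFunctor X).map_zero, CategoryTheory.Quotient.functor_map_eq_iff, factorRel]
  simp only [sub_zero]

/-- A morphism from a complex concentrated in degree `p` to a complex whose term in degree `p - 1`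
lies in `X` vanishes in `K^b(C/[X])` only if its component in degree `p` factors through `X`. -/
lemma exists_factor_of_isZero_source {x y : Kb C} (φ : x.obj.as ⟶ y.obj.as) (p : ℤ)
    (hx : ∀ i ≠ p, IsZero (x.obj.as.X i)) (hy : X (y.obj.as.X (p - 1)))
    (h : (mapKb (factorFunctor X)).map (kbMap φ : x ⟶ y) = 0) :
    ∃ (Z : C) (_ : X Z) (g : x.obj.as.X p ⟶ Z) (k : Z ⟶ y.obj.as.X p), g ≫ k = φ.f p := by
  rw [← factorFunctor_map_eq_zero_iff]
  obtain ⟨k, hk⟩ := (kbMap_eq_zero_iff_of_isZero_source (x := (mapKb (factorFunctor X)).obj x)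
    (y := (mapKb (factorFunctor X)).obj y)
    (((factorFunctor X).mapHomologicalComplex (.up ℤ)).map φ) p
    (fun i hi => (factorFunctor X).map_isZero (hx i hi))).1 h
  rw [(isZero_factorFunctor_obj X hy).eq_of_tgt k 0] at hk
  exact hk.trans zero_comp

/-- A morphism to a complex concentrated in degree `p` from a complex whose term in degree `p + 1`
lies in `X` vanishes in `K^b(C/[X])` only if its component in degree `p` factors through `X`. -/
lemma exists_factor_of_isZero_target {x y : Kb C} (φ : x.obj.as ⟶ y.obj.as) (p : ℤ)
    (hy : ∀ i ≠ p, IsZero (y.obj.as.X i)) (hx : X (x.obj.as.X (p + 1)))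
    (h : (mapKb (factorFunctor X)).map (kbMap φ : x ⟶ y) = 0) :
    ∃ (Z : C) (_ : X Z) (g : x.obj.as.X p ⟶ Z) (k : Z ⟶ y.obj.as.X p), g ≫ k = φ.f p := by
  rw [← factorFunctor_map_eq_zero_iff]
  obtain ⟨k, hk⟩ := (kbMap_eq_zero_iff_of_isZero_target (x := (mapKb (factorFunctor X)).obj x)
    (y := (mapKb (factorFunctor X)).obj y)
    (((factorFunctor X).mapHomologicalComplex (.up ℤ)).map φ) p
    (fun i hi => (factorFunctor X).map_isZero (hy i hi))).1 h
  rw [(isZero_factorFunctor_obj X hx).eq_of_src k 0] at hk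
  exact hk.trans comp_zero

end Homotopy

/-! ### A short exact sequence as an acyclic complex -/

section Abelian

variable {A : Type u} [Category.{v} A] [Abelian A]

instance : (isProjective A).IsClosedUnderIsomorphisms where
  of_iso e h := Projective.of_iso e h

instance : (isInjective A).IsClosedUnderIsomorphisms where
  of_iso e h := Injective.of_iso e h

/-- A short complex `X₁ ⟶ X₂ ⟶ X₃` in degrees `n - 2`, `n - 1`, `n`, constructed as the mapping
cone of the morphism from the cone of `X₁ ⟶ X₂` to `X₃`. -/
def shortComplexCone (S : ShortComplex A) (n : ℤ) : CochainComplex A ℤ :=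
  CochainComplex.mappingCone (CochainComplex.mappingCone.descShortComplex
    (S.map (HomologicalComplex.single A (.up ℤ) n)))

lemma boundedComplex_single (a : A) (n : ℤ) :
    boundedComplex A ((HomologicalComplex.single A (.up ℤ) n).obj a) :=
  (stalk a n).property

lemma boundedComplex_cone_single {a b : A} (f : a ⟶ b) (n : ℤ) :
    boundedComplex A (CochainComplex.mappingCone
      ((HomologicalComplex.single A (.up ℤ) n).map f)) :=
  boundedComplex_mappingCone _ (boundedComplex_single a n) (boundedComplex_single b n)

variable (S : ShortComplex A) (n : ℤ)

/-- The complex `X₁ ⟶ X₂ ⟶ X₃` as an object of `K^b(A)`. -/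
def kbShortComplex : Kb A :=
  kbObj (shortComplexCone S n) (boundedComplex_mappingCone _ (boundedComplex_cone_single S.f n)
    (boundedComplex_single S.X₃ n))

lemma isZero_shortComplexCone_X (i : ℤ) (hi : i < n - 2 ∨ n < i) :
    IsZero ((shortComplexCone S n).X i) := by
  have h (a : A) (j : ℤ) (hj : j ≠ n) := HomologicalComplex.isZero_single_obj_X (.up ℤ) n a j hj
  exact (CochainComplex.mappingCone.isZero_X_iff _ _).2
    ⟨(CochainComplex.mappingCone.isZero_X_iff _ _).2 ⟨h _ _ (by omega), h _ _ (by omega)⟩,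
      h _ _ (by omega)⟩

section

variable (X : ObjectProperty A) [X.ContainsZero] [X.IsClosedUnderIsomorphisms]

lemma prop_single_X {a : A} (ha : X a) (i : ℤ) :
    X (((HomologicalComplex.single A (.up ℤ) n).obj a).X i) := by
  by_cases hi : i = n
  · exact X.prop_of_iso (HomologicalComplex.singleObjXIsoOfEq (.up ℤ) n a i hi).symm ha
  · exact X.prop_of_isZero (HomologicalComplex.isZero_single_obj_X (.up ℤ) n a i hi)

lemma prop_single_X_of_ne (a : A) {i : ℤ} (hi : i ≠ n) :
    X (((HomologicalComplex.single A (.up ℤ) n).obj a).X i) :=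
  X.prop_of_isZero (HomologicalComplex.isZero_single_obj_X (.up ℤ) n a i hi)

variable [X.IsClosedUnderBinaryProducts]

lemma prop_shortComplexCone_X (h₂ : X S.X₂) : X ((shortComplexCone S n).X (n - 1)) :=
  prop_mappingCone_X X _ _ (prop_mappingCone_X X _ _ (prop_single_X_of_ne _ _ _ (by omega))
    (prop_single_X _ _ h₂ _)) (prop_single_X_of_ne _ _ _ (by omega))

/-- If `X₁` and `X₂` lie in `X`, then `X₃` is isomorphic to the complex `X₁ ⟶ X₂ ⟶ X₃` in
the Verdier quotient. -/
lemma nonempty_iso_of_prop_X₁_X₂ (h₁ : X S.X₁) (h₂ : X S.X₂) :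
    Nonempty ((verdierQ X).obj (stalk S.X₃ n) ≅ (verdierQ X).obj (kbShortComplex S n)) := by
  obtain ⟨w, hw⟩ := exists_cone_distinguished
    (x := kbObj _ (boundedComplex_cone_single S.f n)) (y := stalk S.X₃ n)
    (CochainComplex.mappingCone.descShortComplex
      (S.map (HomologicalComplex.single A (.up ℤ) n))) (kbShortComplex S n).property
  have hW := ObjectProperty.trW.mk' (KbSub X) hw (fun i =>
    prop_mappingCone_X X _ _ (prop_single_X _ _ h₁ _) (prop_single_X _ _ h₂ _))
  exact ⟨Localization.isoOfHom (verdierQ X) (KbSub X).trW _ hW⟩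

/-- In the Verdier quotient, the cone of a morphism `a ⟶ b` with `b` in `X` is isomorphic to the
shift of `a`. -/
lemma nonempty_iso_cone_single_of_prop {a b : A} (f : a ⟶ b) (hb : X b) :
    Nonempty ((verdierQ X).obj (kbObj _ (boundedComplex_cone_single f n)) ≅
      (verdierQ X).obj (stalk a (n - 1))) := by
  obtain ⟨w, hw⟩ := exists_cone_distinguished (x := stalk a n) (y := stalk b n)
    ((HomologicalComplex.single A (.up ℤ) n).map f) (boundedComplex_cone_single f n)
  have hW := ObjectProperty.trW.mk' (KbSub X) (rot_of_distTriang _ hw) (prop_single_X _ _ hb)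
  exact ⟨Localization.isoOfHom (verdierQ X) (KbSub X).trW _ hW ≪≫
    (verdierQ X).mapIso (stalkShiftIso a 1 (n - 1) n (by omega))⟩

/-- If `X₂` and `X₃` lie in `X`, then `X₁` is isomorphic to the complex `X₁ ⟶ X₂ ⟶ X₃` in
the Verdier quotient. -/
lemma nonempty_iso_of_prop_X₂_X₃ (h₂ : X S.X₂) (h₃ : X S.X₃) :
    Nonempty ((verdierQ X).obj (kbShortComplex S n) ≅ (verdierQ X).obj (stalk S.X₁ (n - 2))) := by
  obtain ⟨w, hw⟩ := exists_cone_distinguished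
    (x := kbObj _ (boundedComplex_cone_single S.f n)) (y := stalk S.X₃ n)
    (CochainComplex.mappingCone.descShortComplex
      (S.map (HomologicalComplex.single A (.up ℤ) n))) (kbShortComplex S n).property
  have hW := ObjectProperty.trW.mk' (KbSub X) (rot_of_distTriang _ hw) (prop_single_X _ _ h₃)
  obtain ⟨e⟩ := nonempty_iso_cone_single_of_prop n X S.f h₂
  exact ⟨Localization.isoOfHom (verdierQ X) (KbSub X).trW _ hW ≪≫
    ((verdierQ X).commShiftIso (1 : ℤ)).app _ ≪≫ (shiftFunctor _ (1 : ℤ)).mapIso e ≪≫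
    ((verdierQ X).commShiftIso (1 : ℤ)).symm.app _ ≪≫
    (verdierQ X).mapIso (stalkShiftIso S.X₁ 1 (n - 2) (n - 1) (by omega))⟩

end

variable {S}

lemma acyclic_shortComplexCone (hS : S.ShortExact) : (shortComplexCone S n).Acyclic := by
  have hS' := hS.map_of_exact (HomologicalComplex.single A (.up ℤ) n)
  have hq := CochainComplex.mappingCone.quasiIso_descShortComplex hS'
  rw [← HomotopyCategory.quotient_obj_mem_subcategoryAcyclic_iff_acyclic]
  refine ((HomotopyCategory.subcategoryAcyclic A).trW_iff_of_distinguished _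
    (HomotopyCategory.mappingCone_triangleh_distinguished _)).1 ?_
  rw [← HomotopyCategory.quasiIso_eq_trW_subcategoryAcyclic]
  exact (HomotopyCategory.quotient_map_mem_quasiIso_iff _).2 hq

end Abelian

section Abelian

variable {A : Type u} [Category.{v} A] [Abelian A]

/-! ### Hereditary categories: the canonical functors are equivalences -/

/-- Bounded complexes of projectives are K-projective. -/
lemma rightOrthogonal_of_acyclic {y : Kb A} (hy : y.obj.as.Acyclic) :
    (KbSub (isProjective A)).rightOrthogonal y := fun x f hx => by
  obtain ⟨φ, rfl⟩ := kbMap_surjective f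
  obtain ⟨m, n, h⟩ := x.property
  have : ∀ i, Projective (x.obj.as.X i) := hx
  have : CochainComplex.IsStrictlyLE x.obj.as n :=
    (CochainComplex.isStrictlyLE_iff _ _).2 fun i hi => h i (.inr hi)
  have := CochainComplex.isKProjective_of_projective x.obj.as n
  rw [← kbMap_zero, kbMap_eq_iff]
  exact ⟨CochainComplex.IsKProjective.homotopyZero φ hy⟩

/-- Bounded complexes of injectives are K-injective. -/
lemma leftOrthogonal_of_acyclic {x : Kb A} (hx : x.obj.as.Acyclic) :
    (KbSub (isInjective A)).leftOrthogonal x := fun y f hy => by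
  obtain ⟨φ, rfl⟩ := kbMap_surjective f
  obtain ⟨m, n, h⟩ := y.property
  have : ∀ i, Injective (y.obj.as.X i) := hy
  have : CochainComplex.IsStrictlyGE y.obj.as m :=
    (CochainComplex.isStrictlyGE_iff _ _).2 fun i hi => h i (.inl hi)
  have := CochainComplex.isKInjective_of_injective y.obj.as m
  rw [← kbMap_zero, kbMap_eq_iff]
  exact ⟨CochainComplex.IsKInjective.homotopyZero φ hx⟩

lemma exact_of_acyclic {K : CochainComplex A ℤ} (hK : K.Acyclic) (i j k : ℤ) (hij : i + 1 = j)
    (hjk : j + 1 = k) : (K.sc' i j k).Exact :=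
  (K.exactAt_iff' i j k (by simp; omega) (by simp; omega)).1 (hK j)

variable {S : ShortComplex A} (n : ℤ)

/-- For an exact sequence `X₁ ⟶ X₂ ⟶ X₃` with `X₂` projective, the projection
`K^b(A) ⥤ K^b(A/[P])` kills no nonzero morphism from a stalk complex to `X₁ ⟶ X₂ ⟶ X₃`. -/
lemma eq_zero_of_map_eq_zero_of_projective (hS : S.ShortExact) (h₂ : Projective S.X₂) (a : A)
    (p : ℤ) (g : stalk a p ⟶ kbShortComplex S n)
    (hg : (mapKb (factorFunctor (isProjective A))).map g = 0) : g = 0 := by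
  obtain ⟨φ, rfl⟩ := kbMap_surjective g
  have hK := acyclic_shortComplexCone n hS
  have hz := isZero_shortComplexCone_X S n
  have ha : ∀ i ≠ p, IsZero ((stalk a p).obj.as.X i) := fun i hi => isZero_stalk_X a hi
  change (stalk a p).obj.as ⟶ shortComplexCone S n at φ
  refine (kbMap_eq_zero_iff_of_isZero_source (y := kbShortComplex S n) φ p ha).2 ?_
  change ∃ h, φ.f p = h ≫ (shortComplexCone S n).d (p - 1) p
  have hφ : φ.f p ≫ (shortComplexCone S n).d p (p + 1) = 0 := by
    rw [φ.comm]
    exact (congrArg (· ≫ φ.f (p + 1)) ((ha (p + 1) (by omega)).eq_of_tgt _ 0)).trans zero_comp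
  -- Below degree `n` the component lifts along the injective differential by exactness; in degree
  -- `n` it lifts along the epimorphism `X₂ ⟶ X₃` because it factors through a projective.
  rcases lt_trichotomy p n with hp | rfl | hp
  · have : Mono ((shortComplexCone S n).d (p - 1) p) :=
      (exact_of_acyclic hK (p - 2) (p - 1) p (by omega) (by omega)).mono_g
        ((hz (p - 2) (.inl (by omega))).eq_of_src _ _)
    have ex := exact_of_acyclic hK (p - 1) p (p + 1) (by omega) rfl
    have : Mono ((shortComplexCone S n).sc' (p - 1) p (p + 1)).f := this
    exact ⟨ex.lift (φ.f p) hφ, (ex.lift_f _ _).symm⟩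
  · obtain ⟨Z, hZ, u, w, huw⟩ := exists_factor_of_isZero_source (isProjective A)
      (y := kbShortComplex S p) φ p ha
      (prop_shortComplexCone_X S p (isProjective A) h₂) hg
    have hZ : Projective Z := hZ
    change Z ⟶ (shortComplexCone S p).X p at w
    have : Epi ((shortComplexCone S p).d (p - 1) p) :=
      (exact_of_acyclic hK (p - 1) p (p + 1) (by omega) rfl).epi_f
        ((hz (p + 1) (.inr (by omega))).eq_of_tgt _ _)
    refine ⟨u ≫ Projective.factorThru w ((shortComplexCone S p).d (p - 1) p), ?_⟩
    exact huw.symm.trans ((congrArg (u ≫ ·) (Projective.factorThru_comp w _).symm).trans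
      (Category.assoc _ _ _).symm)
  · exact ⟨0, (hz p (.inr hp)).eq_of_tgt _ _⟩

/-- For an exact sequence `X₁ ⟶ X₂ ⟶ X₃` with `X₂` injective, the projection
`K^b(A) ⥤ K^b(A/[I])` kills no nonzero morphism from `X₁ ⟶ X₂ ⟶ X₃` to a stalk complex. -/
lemma eq_zero_of_map_eq_zero_of_injective (hS : S.ShortExact) (h₂ : Injective S.X₂) (b : A)
    (p : ℤ) (g : kbShortComplex S n ⟶ stalk b p)
    (hg : (mapKb (factorFunctor (isInjective A))).map g = 0) : g = 0 := by
  obtain ⟨φ, rfl⟩ := kbMap_surjective g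
  have hK := acyclic_shortComplexCone n hS
  have hz := isZero_shortComplexCone_X S n
  have hb : ∀ i ≠ p, IsZero ((stalk b p).obj.as.X i) := fun i hi => isZero_stalk_X b hi
  change shortComplexCone S n ⟶ (stalk b p).obj.as at φ
  refine (kbMap_eq_zero_iff_of_isZero_target (x := kbShortComplex S n) φ p hb).2 ?_
  change ∃ h, φ.f p = (shortComplexCone S n).d p (p + 1) ≫ h
  have hφ : (shortComplexCone S n).d (p - 1) p ≫ φ.f p = 0 := by
    rw [← φ.comm]
    exact (congrArg (φ.f (p - 1) ≫ ·) ((hb (p - 1) (by omega)).eq_of_src _ 0)).trans comp_zero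
  -- Above degree `n - 2` exactness suffices; in degree `n - 2` the component extends along the
  -- monomorphism `X₁ ⟶ X₂` because it factors through an injective.
  rcases lt_trichotomy p (n - 2) with hp | hp | hp
  · exact ⟨0, (hz p (.inl hp)).eq_of_src _ _⟩
  · obtain ⟨Z, hZ, u, w, huw⟩ := exists_factor_of_isZero_target (isInjective A)
      (x := kbShortComplex S n) φ p hb (by
      obtain rfl : n = p + 2 := by omega
      have := prop_shortComplexCone_X S (p + 2) (isInjective A) h₂
      rwa [show p + 2 - 1 = p + 1 by omega] at this) hg
    have hZ : Injective Z := hZ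
    change (shortComplexCone S n).X p ⟶ Z at u
    have : Mono ((shortComplexCone S n).d p (p + 1)) :=
      (exact_of_acyclic hK (p - 1) p (p + 1) (by omega) rfl).mono_g
        ((hz (p - 1) (.inl (by omega))).eq_of_src _ _)
    refine ⟨Injective.factorThru u ((shortComplexCone S n).d p (p + 1)) ≫ w, ?_⟩
    exact huw.symm.trans ((congrArg (· ≫ w) (Injective.comp_factorThru u _).symm).trans
      (Category.assoc _ _ _))
  · have : Epi ((shortComplexCone S n).d p (p + 1)) :=
      (exact_of_acyclic hK p (p + 1) (p + 2) rfl (by omega)).epi_f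
        ((hz (p + 2) (.inr (by omega))).eq_of_tgt _ _)
    have ex := exact_of_acyclic hK (p - 1) p (p + 1) (by omega) rfl
    have : Epi ((shortComplexCone S n).sc' (p - 1) p (p + 1)).g := this
    exact ⟨ex.desc (φ.f p) hφ, (ex.g_desc _ _).symm⟩

/-- The canonical functor for the projectives is an equivalence if every object has a projective
resolution of length at most one. -/
theorem isEquivalence_of_projective_resolutions
    (h : ∀ M : A, ∃ S : ShortComplex A, S.ShortExact ∧ S.X₃ = M ∧ Projective S.X₁ ∧
      Projective S.X₂) :
    (canonicalFunctor (isProjective A)).IsEquivalence :=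
  canonicalFunctor_isEquivalence_of_eq_zero _ fun a b p q f hf => by
    obtain ⟨S, hS, rfl, h₁, h₂⟩ := h b
    obtain ⟨e⟩ := nonempty_iso_of_prop_X₁_X₂ S q (isProjective A) h₁ h₂
    obtain ⟨g, hg⟩ := ((rightOrthogonal_of_acyclic
      (acyclic_shortComplexCone q hS)).map_bijective_of_isTriangulated
        (verdierQ (isProjective A)) (stalk a p)).2 (f ≫ e.hom)
    have hg' : g = 0 := eq_zero_of_map_eq_zero_of_projective q hS h₂ a p g (by
      rw [← canonicalFunctor_map_verdierQ_map_eq_zero_iff, hg, Functor.map_comp, hf, zero_comp])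
    rw [← cancel_mono e.hom, ← hg, hg', Functor.map_zero, zero_comp]

/-- The canonical functor for the injectives is an equivalence if every object has an injective
resolution of length at most one. -/
theorem isEquivalence_of_injective_resolutions
    (h : ∀ M : A, ∃ S : ShortComplex A, S.ShortExact ∧ S.X₁ = M ∧ Injective S.X₂ ∧
      Injective S.X₃) :
    (canonicalFunctor (isInjective A)).IsEquivalence :=
  canonicalFunctor_isEquivalence_of_eq_zero _ fun a b p q f hf => by
    obtain ⟨S, hS, rfl, h₂, h₃⟩ := h a
    obtain ⟨e⟩ := nonempty_iso_of_prop_X₂_X₃ S (p + 2) (isInjective A) h₂ h₃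
    rw [add_sub_cancel_right] at e
    obtain ⟨g, hg⟩ := ((leftOrthogonal_of_acyclic
      (acyclic_shortComplexCone (p + 2) hS)).map_bijective_of_isTriangulated
        (verdierQ (isInjective A)) (stalk b q)).2 (e.hom ≫ f)
    have hg' : g = 0 := eq_zero_of_map_eq_zero_of_injective (p + 2) hS h₂ b q g (by
      rw [← canonicalFunctor_map_verdierQ_map_eq_zero_iff, hg, Functor.map_comp, hf, comp_zero])
    rw [← cancel_epi e.hom, ← hg, hg', Functor.map_zero, comp_zero]

end Abelian

section Abelian

variable {A : Type u} [Category.{v} A] [Abelian A] {S : ShortComplex A}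

/-! ### Faithful canonical functors force the category to be hereditary -/

/-- If the first map of a short exact sequence with projective middle term factors through a
complex `N₁ ⟶ N₀` of projectives mapping to `X₂ ⟶ X₃`, then `X₁` is projective. -/
lemma projective_X₁_of_factor (hS : S.ShortExact) {N₁ N₀ : A} [Projective N₁] [Projective N₀]
    (u : S.X₁ ⟶ N₁) (d : N₁ ⟶ N₀) (q : N₁ ⟶ S.X₂) (w : N₀ ⟶ S.X₃) (huq : u ≫ q = S.f)
    (hud : u ≫ d = 0) (hdw : d ≫ w = q ≫ S.g) : Projective S.X₁ := by
  have := hS.mono_f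
  have := hS.epi_g
  -- Subtracting a lift of `d ≫ w` corrects `q` to a map into the kernel of `X₂ ⟶ X₃`, without
  -- changing its composition with `u`.
  let r := hS.exact.lift (q - d ≫ Projective.factorThru w S.g) (by simp [hdw])
  have hr : r ≫ S.f = q - d ≫ Projective.factorThru w S.g := hS.exact.lift_f _ _
  have hur : u ≫ r = 𝟙 _ := by
    rw [← cancel_mono S.f, Category.assoc, hr, Preadditive.comp_sub, huq, reassoc_of% hud]
    simp
  exact Retract.projective ⟨u, r, hur⟩

/-- If the second map of a short exact sequence factors through a complex `N₁ ⟶ N₀` of injectives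
to which `X₁ ⟶ X₂` maps, then `X₃` is injective. -/
lemma injective_X₃_of_factor (hS : S.ShortExact) {N₁ N₀ : A} [Injective N₁] [Injective N₀]
    (u : N₀ ⟶ S.X₃) (d : N₁ ⟶ N₀) (q : S.X₂ ⟶ N₀) (w : S.X₁ ⟶ N₁) (hqu : q ≫ u = S.g)
    (hdu : d ≫ u = 0) (hwd : w ≫ d = S.f ≫ q) : Injective S.X₃ := by
  have := hS.mono_f
  have := hS.epi_g
  have hw : S.f ≫ Injective.factorThru w S.f = w := Injective.comp_factorThru _ _
  let r := hS.exact.desc (q - Injective.factorThru w S.f ≫ d) (by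
    rw [Preadditive.comp_sub, reassoc_of% hw, hwd, sub_self])
  have hr : S.g ≫ r = q - Injective.factorThru w S.f ≫ d := hS.exact.g_desc _ _
  have hru : r ≫ u = 𝟙 _ := by
    rw [← cancel_epi S.g, reassoc_of% hr, Preadditive.sub_comp, hqu, Category.assoc, hdu]
    simp
  exact Retract.injective ⟨r, u, hru⟩

variable (S)

/-- For a complex `X₁ ⟶ X₂ ⟶ X₃`, the morphism from `X₁` in degree `-1` to the cone of `X₂ ⟶ X₃`,
whose terms are `X₂` in degree `-1` and `X₃` in degree `0`. -/
def toConeSingle : (HomologicalComplex.single A (.up ℤ) (-1 : ℤ)).obj S.X₁ ⟶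
    CochainComplex.mappingCone ((HomologicalComplex.single A (.up ℤ) (0 : ℤ)).map S.g) :=
  HomologicalComplex.mkHomFromSingle
    (S.f ≫ (HomologicalComplex.singleObjXSelf (.up ℤ) (0 : ℤ) S.X₂).inv ≫
      (CochainComplex.mappingCone.inl _).v 0 (-1) (by omega)) (by
    rintro k hk
    obtain rfl : k = 0 := by simp at hk; omega
    simp only [Category.assoc, CochainComplex.mappingCone.inl_v_d _ 0 (-1) 1 (by omega)
      (by omega), HomologicalComplex.single_map_f_self]
    simp)

lemma toConeSingle_f : (toConeSingle S).f (-1) =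
    (HomologicalComplex.singleObjXSelf (.up ℤ) (-1 : ℤ) S.X₁).hom ≫ S.f ≫
      (HomologicalComplex.singleObjXSelf (.up ℤ) (0 : ℤ) S.X₂).inv ≫
      (CochainComplex.mappingCone.inl _).v 0 (-1) (by omega) :=
  HomologicalComplex.mkHomFromSingle_f _ _

/-- For a complex `X₁ ⟶ X₂ ⟶ X₃`, the morphism to `X₃` in degree `0` from the cone of `X₁ ⟶ X₂`,
whose terms are `X₁` in degree `-1` and `X₂` in degree `0`. -/
def fromConeSingle :
    CochainComplex.mappingCone ((HomologicalComplex.single A (.up ℤ) (0 : ℤ)).map S.f) ⟶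
      (HomologicalComplex.single A (.up ℤ) (0 : ℤ)).obj S.X₃ :=
  HomologicalComplex.mkHomToSingle
    ((CochainComplex.mappingCone.snd _).v 0 0 (by omega) ≫
      (HomologicalComplex.singleObjXSelf (.up ℤ) (0 : ℤ) S.X₂).hom ≫ S.g) (by
    rintro k hk
    obtain rfl : k = -1 := by simp at hk; omega
    rw [CochainComplex.mappingCone.d_snd_v_assoc _ (-1) 0 (by omega),
      HomologicalComplex.single_map_f_self]
    simp)

lemma fromConeSingle_f : (fromConeSingle S).f 0 =
    ((CochainComplex.mappingCone.snd _).v 0 0 (by omega) ≫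
      (HomologicalComplex.singleObjXSelf (.up ℤ) (0 : ℤ) S.X₂).hom ≫ S.g) ≫
      (HomologicalComplex.singleObjXSelf (.up ℤ) (0 : ℤ) S.X₃).inv :=
  HomologicalComplex.mkHomToSingle_f _ _

lemma isZero_cone_single_X {a b : A} (f : a ⟶ b) (n i : ℤ) (h₀ : i ≠ n) (h₁ : i ≠ n - 1) :
    IsZero ((CochainComplex.mappingCone ((HomologicalComplex.single A (.up ℤ) n).map f)).X i) :=
  (CochainComplex.mappingCone.isZero_X_iff _ _).2
    ⟨HomologicalComplex.isZero_single_obj_X _ _ _ _ (by omega),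
      HomologicalComplex.isZero_single_obj_X _ _ _ _ h₀⟩

variable {S}

/-- If `toConeSingle S` factors up to homotopy through a complex of projectives, then `X₁` is
projective. In degree `-1` there is no room for a nonzero homotopy, so that the factorization is
strict there and `projective_X₁_of_factor` applies. -/
lemma projective_X₁_of_homotopy (hS : S.ShortExact) {N : CochainComplex A ℤ}
    (hN : ∀ i, Projective (N.X i))
    (a : (HomologicalComplex.single A (.up ℤ) (-1 : ℤ)).obj S.X₁ ⟶ N)
    (b : N ⟶ CochainComplex.mappingCone ((HomologicalComplex.single A (.up ℤ) (0 : ℤ)).map S.g))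
    (H : Homotopy (toConeSingle S) (a ≫ b)) : Projective S.X₁ := by
  have hα : (toConeSingle S).f (-1) = a.f (-1) ≫ b.f (-1) := by
    have h := H.comm (-1)
    rw [dNext_eq (i := -1) (i' := 0) _ (by simp), prevD_eq (j := -1) (j' := -2) _ (by simp),
      (HomologicalComplex.isZero_single_obj_X _ (-1 : ℤ) S.X₁ 0 (by simp)).eq_of_src
        (H.hom 0 (-1)) 0,
      (isZero_cone_single_X S.g 0 (-2) (by omega) (by omega)).eq_of_tgt (H.hom (-1) (-2)) 0] at h
    simpa using h
  have := hN (-1)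
  have := hN 0
  refine projective_X₁_of_factor hS
    ((HomologicalComplex.singleObjXSelf (.up ℤ) (-1 : ℤ) S.X₁).inv ≫ a.f (-1)) (N.d (-1) 0)
    (b.f (-1) ≫ (CochainComplex.mappingCone.fst _).1.v (-1) 0 (by omega) ≫
      (HomologicalComplex.singleObjXSelf (.up ℤ) (0 : ℤ) S.X₂).hom)
    (b.f 0 ≫ (CochainComplex.mappingCone.snd _).v 0 0 (by omega) ≫
      (HomologicalComplex.singleObjXSelf (.up ℤ) (0 : ℤ) S.X₃).hom) ?_ ?_ ?_
  · rw [Category.assoc, ← reassoc_of% hα, toConeSingle_f]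
    simp
  · rw [Category.assoc, a.comm, HomologicalComplex.single_obj_d, zero_comp, comp_zero]
  · rw [← b.comm_assoc, CochainComplex.mappingCone.d_snd_v_assoc _ (-1) 0 (by omega),
      HomologicalComplex.single_map_f_self]
    simp

/-- If `fromConeSingle S` factors up to homotopy through a complex of injectives, then `X₃` is
injective; the homotopy vanishes in degree `0`. -/
lemma injective_X₃_of_homotopy (hS : S.ShortExact) {N : CochainComplex A ℤ}
    (hN : ∀ i, Injective (N.X i))
    (a : CochainComplex.mappingCone ((HomologicalComplex.single A (.up ℤ) (0 : ℤ)).map S.f) ⟶ N)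
    (b : N ⟶ (HomologicalComplex.single A (.up ℤ) (0 : ℤ)).obj S.X₃)
    (H : Homotopy (fromConeSingle S) (a ≫ b)) : Injective S.X₃ := by
  have hα : (fromConeSingle S).f 0 = a.f 0 ≫ b.f 0 := by
    have h := H.comm 0
    rw [dNext_eq (i := 0) (i' := 1) _ (by simp), prevD_eq (j := 0) (j' := -1) _ (by simp),
      (HomologicalComplex.isZero_single_obj_X _ (0 : ℤ) S.X₃ (-1) (by simp)).eq_of_tgt
        (H.hom 0 (-1)) 0,
      (isZero_cone_single_X S.f 0 1 (by omega) (by omega)).eq_of_src (H.hom 1 0) 0] at h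
    simpa using h
  have := hN (-1)
  have := hN 0
  refine injective_X₃_of_factor hS
    (b.f 0 ≫ (HomologicalComplex.singleObjXSelf (.up ℤ) (0 : ℤ) S.X₃).hom) (N.d (-1) 0)
    ((HomologicalComplex.singleObjXSelf (.up ℤ) (0 : ℤ) S.X₂).inv ≫
      (CochainComplex.mappingCone.inr _).f 0 ≫ a.f 0)
    ((HomologicalComplex.singleObjXSelf (.up ℤ) (0 : ℤ) S.X₁).inv ≫
      (CochainComplex.mappingCone.inl _).v 0 (-1) (by omega) ≫ a.f (-1)) ?_ ?_ ?_
  · simp only [Category.assoc]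
    rw [← reassoc_of% hα, fromConeSingle_f]
    simp
  · rw [← b.comm_assoc, HomologicalComplex.single_obj_d, zero_comp, comp_zero]
  · simp only [Category.assoc]
    rw [a.comm, CochainComplex.mappingCone.inl_v_d_assoc _ 0 (-1) 1 (by omega) (by omega),
      HomologicalComplex.single_map_f_self]
    simp

/-- The canonical functor kills the morphism from `X₁`, in degree `-1`, to the cone of
`X₂ ⟶ X₃`, because in the Verdier quotient that cone is `X₃` in degree `0`. -/
lemma projective_X₁_of_faithful [(canonicalFunctor (isProjective A)).Faithful]
    (hS : S.ShortExact) (h₂ : Projective S.X₂) : Projective S.X₁ := by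
  let c : Kb A := kbObj _ (boundedComplex_cone_single S.g 0)
  let α : stalk S.X₁ (-1) ⟶ c := kbMap (toConeSingle S)
  obtain ⟨w, hw⟩ := exists_cone_distinguished (x := stalk S.X₂ 0) (y := stalk S.X₃ 0)
    ((HomologicalComplex.single A (.up ℤ) (0 : ℤ)).map S.g) c.property
  have hW := ObjectProperty.trW.mk' (KbSub (isProjective A)) hw (prop_single_X _ _ h₂)
  let e : (verdierQ (isProjective A)).obj (stalk S.X₃ 0) ≅ (verdierQ (isProjective A)).obj c :=
    Localization.isoOfHom (verdierQ (isProjective A)) (KbSub (isProjective A)).trW _ hW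
  have hQ : (verdierQ (isProjective A)).map α = 0 := by
    rw [← cancel_mono e.inv, zero_comp]
    exact (canonicalFunctor (isProjective A)).map_injective
      ((canonicalFunctor_map_eq_zero_of_ne _ _ _ (by omega) _).trans
        (canonicalFunctor_map_eq_zero_of_ne _ _ _ (by omega) 0).symm)
  obtain ⟨N, hN, a, b, hab⟩ := exists_factor_of_verdierQ_map_eq_zero _ _ hQ
  obtain ⟨a, rfl⟩ := kbMap_surjective a
  obtain ⟨b, rfl⟩ := kbMap_surjective b
  obtain ⟨H⟩ := (kbMap_eq_iff (x := stalk S.X₁ (-1)) (y := c) (toConeSingle S) (a ≫ b)).1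
    (hab.trans (kbMap_comp a b).symm)
  exact projective_X₁_of_homotopy hS hN a b H

/-- The canonical functor kills the morphism to `X₃`, in degree `0`, from the cone of
`X₁ ⟶ X₂`, because in the Verdier quotient that cone is `X₁` in degree `-1`. -/
lemma injective_X₃_of_faithful [(canonicalFunctor (isInjective A)).Faithful]
    (hS : S.ShortExact) (h₂ : Injective S.X₂) : Injective S.X₃ := by
  let c : Kb A := kbObj _ (boundedComplex_cone_single S.f 0)
  let γ : c ⟶ stalk S.X₃ 0 := kbMap (fromConeSingle S)
  obtain ⟨e⟩ := nonempty_iso_cone_single_of_prop 0 (isInjective A) S.f h₂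
  have hQ : (verdierQ (isInjective A)).map γ = 0 := by
    rw [← cancel_epi e.inv, comp_zero]
    exact (canonicalFunctor (isInjective A)).map_injective
      ((canonicalFunctor_map_eq_zero_of_ne _ _ _ (by omega) _).trans
        (canonicalFunctor_map_eq_zero_of_ne _ _ _ (by omega) 0).symm)
  obtain ⟨N, hN, a, b, hab⟩ := exists_factor_of_verdierQ_map_eq_zero _ _ hQ
  obtain ⟨a, rfl⟩ := kbMap_surjective a
  obtain ⟨b, rfl⟩ := kbMap_surjective b
  obtain ⟨H⟩ := (kbMap_eq_iff (x := c) (y := stalk S.X₃ 0) (fromConeSingle S) (a ≫ b)).1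
    (hab.trans (kbMap_comp a b).symm)
  exact injective_X₃_of_homotopy hS hN a b H

/-! ### Hereditary categories in terms of short exact sequences -/

/-- Both conditions say that `Ext^i` vanishes for `i ≥ 2`. -/
lemma isHereditary_iff_hasInjectiveDimensionLT :
    IsHereditary A ↔ ∀ M : A, HasInjectiveDimensionLT M 2 := by
  have := HasExt.standard A
  exact ⟨fun h M => (hasInjectiveDimensionLT_iff M 2).2 fun i hi Y e =>
      (hasProjectiveDimensionLT_iff Y 2).1 (h Y) i hi e,
    fun h M => (hasProjectiveDimensionLT_iff M 2).2 fun i hi Y e =>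
      (hasInjectiveDimensionLT_iff Y 2).1 (h Y) i hi e⟩

lemma isHereditary_iff_projective [EnoughProjectives A] :
    IsHereditary A ↔ ∀ S : ShortComplex A, S.ShortExact → Projective S.X₂ → Projective S.X₁ := by
  refine ⟨fun h S hS h₂ => projective_iff_hasProjectiveDimensionLT_one.2
    ((hS.hasProjectiveDimensionLT_X₃_iff 0 h₂).1 (h _)), fun h M => ?_⟩
  have hS : (ShortComplex.mk _ _ (kernel.condition (Projective.π M))).ShortExact :=
    { exact := ShortComplex.exact_kernel _ }
  exact (hS.hasProjectiveDimensionLT_X₃_iff 0 inferInstance).2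
    (projective_iff_hasProjectiveDimensionLT_one.1 (h _ hS inferInstance))

lemma isHereditary_iff_injective [EnoughInjectives A] :
    IsHereditary A ↔ ∀ S : ShortComplex A, S.ShortExact → Injective S.X₂ → Injective S.X₃ := by
  rw [isHereditary_iff_hasInjectiveDimensionLT]
  refine ⟨fun h S hS h₂ => injective_iff_hasInjectiveDimensionLT_one.2
    ((hS.hasInjectiveDimensionLT_X₃_iff 0 h₂).2 (h _)), fun h M => ?_⟩
  have hS : (ShortComplex.mk _ _ (cokernel.condition (Injective.ι M))).ShortExact :=
    { exact := ShortComplex.exact_cokernel _ }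
  exact (hS.hasInjectiveDimensionLT_X₃_iff 0 inferInstance).1
    (injective_iff_hasInjectiveDimensionLT_one.1 (h _ hS inferInstance))

theorem isEquivalence_projective_iff [EnoughProjectives A] :
    (canonicalFunctor (isProjective A)).IsEquivalence ↔ IsHereditary A := by
  rw [isHereditary_iff_projective]
  refine ⟨fun _ S hS h₂ => projective_X₁_of_faithful hS h₂, fun h =>
    isEquivalence_of_projective_resolutions fun M => ?_⟩
  have hS : (ShortComplex.mk _ _ (kernel.condition (Projective.π M))).ShortExact :=
    { exact := ShortComplex.exact_kernel _ }
  exact ⟨_, hS, rfl, h _ hS inferInstance, inferInstance⟩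

theorem isEquivalence_injective_iff [EnoughInjectives A] :
    (canonicalFunctor (isInjective A)).IsEquivalence ↔ IsHereditary A := by
  rw [isHereditary_iff_injective]
  refine ⟨fun _ S hS h₂ => injective_X₃_of_faithful hS h₂, fun h =>
    isEquivalence_of_injective_resolutions fun M => ?_⟩
  have hS : (ShortComplex.mk _ _ (cokernel.condition (Injective.ι M))).ShortExact :=
    { exact := ShortComplex.exact_cokernel _ }
  exact ⟨_, hS, rfl, inferInstance, h _ hS inferInstance⟩

end Abelian

end AdditiveQuotient

end

theorem corollary4p6 {A : Type u} [Category.{v} A] [Abelian A]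
    [EnoughProjectives A] [EnoughInjectives A] :
    List.TFAE
      [(AdditiveQuotient.canonicalFunctor (isProjective A)).IsEquivalence,
       AdditiveQuotient.IsHereditary A,
       (AdditiveQuotient.canonicalFunctor (isInjective A)).IsEquivalence] := by
  tfae_have 1 ↔ 2 := AdditiveQuotient.isEquivalence_projective_iff
  tfae_have 3 ↔ 2 := AdditiveQuotient.isEquivalence_injective_iff
  tfae_finish
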